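/- A mixed-sign Coxeter graph $\Gamma$ with vertices $s_1,\dots,s_n$ consists of edge weights $m_{i,j}=m_{j,i}\in\{2,3,\dots\}\cup\{\infty\}$ for $i\ne j$ (where $s_i,s_j$ are joined by an edge if and only if $m_{i,j}\neq 2$) and a sign $f_i\in\{+1,-1\}$ at each vertex $s_i$. Let $B$ be the symmetric bilinear form on $\mathbb{R}^n$ with $B(e_i,e_i)=2f_i$ and, for $i\neq j$, $B(e_i,e_j)=-2\cos(\pi/m_{i,j})$ (which is $-2$ if $m_{i,j}=\infty$), and let $W(\Gamma)\le GL_n(\mathbb{R})$ be the group generated by the reflections $$\pi_{s_i}(e_j)=e_j-\frac{2B(e_i,e_j)}{B(e_i,e_i)}\,e_i,\qquad 1\le i\le n.$$ Let $n\ge 3$ and let $\Gamma$ be a mixed-sign Coxeter graph that is a simply-laced simple cycle with $n$ vertices (all edges have weight $3$). 1. If all vertices of $\Gamma$ are signed $+1$, then $W(\Gamma)\cong\widetilde S_n$. 2. If all vertices of $\Gamma$ are signed $-1$, then $W(\Gamma)\cong\widetilde S_n$ when $n$ is even, and $W(\Gamma)\cong D_n$ when $n$ is odd. Here $\widetilde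 S_n$ is the affine symmetric group, i.e. the Coxeter group $\langle s_1,\dots,s_n\mid s_i^2=1,\ (s_is_j)^{m_{i,j}}=1\rangle$ whose Coxeter graph is the simply-laced $n$-cycle ($m_{i,j}=3$ if $i-j\equiv\pm1 \pmod n$, and $m_{i,j}=2$ for all other $i\neq j$), and $D_n$ is the Coxeter group of type $D$ and rank $n$, whose simply-laced Coxeter graph is a path $t_1,\dots,t_{n-1}$ together with one more vertex $t_n$ joined only to $t_{n-2}$ (so $D_3=A_3$). -/

import Mathlib

noncomputable section

open scoped Classical in
/-- The simply-laced Coxeter matrix with Coxeter graph `G`: the order of the product of two distinct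
generators is `3` if they are joined by an edge of `G` and `2` otherwise. -/
def simplyLacedCoxeterMatrix {V : Type*} (G : SimpleGraph V) : CoxeterMatrix V where
  M := Matrix.of fun i j => if i = j then 1 else if G.Adj i j then 3 else 2
  isSymm := by
    ext i j
    simp only [Matrix.transpose_apply, Matrix.of_apply, eq_comm (a := j), G.adj_comm j]
  diagonal i := by simp
  off_diagonal i j h := by
    simp only [Matrix.of_apply, if_neg h]
    split_ifs <;> decide

/-- For `n ≥ 3`, the affine symmetric group `S̃ₙ`, that is, the Coxeter group whose Coxeter graph is
the simply-laced cycle with `n` vertices (affine type `A` of rank `n`). -/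
abbrev AffineSymmetricGroup (n : ℕ) : Type :=
  (simplyLacedCoxeterMatrix (SimpleGraph.cycleGraph n)).Group

/-- For `n ≥ 3`, the Coxeter graph of type `Dₙ` on the vertices `0, …, n - 1`: the path
`0 - 1 - ⋯ - (n - 2)` together with the vertex `n - 1`, which is joined to `n - 3` only.
(Mathlib's `CoxeterMatrix.D` also joins `n - 2` to `n - 1`, hence is not used here.) -/
def typeDGraph (n : ℕ) : SimpleGraph (Fin n) :=
  SimpleGraph.fromRel fun i j : Fin n =>
    ((i : ℕ) + 1 = j ∧ (j : ℕ) + 1 < n) ∨ ((i : ℕ) + 2 = j ∧ (j : ℕ) + 1 = n)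

/-- For `n ≥ 3`, the Coxeter group of type `Dₙ`. -/
abbrev TypeDCoxeterGroup (n : ℕ) : Type :=
  (simplyLacedCoxeterMatrix (typeDGraph n)).Group

/-- A mixed-sign Coxeter graph with vertex set `V`: the edge weights `m i j` (encoded by a Coxeter
matrix, in which the entry `0` stands for `∞`) together with a sign `+1` or `-1` at each vertex. -/
structure MixedSignCoxeterGraph (V : Type*) where
  /-- The edge weights. -/
  m : CoxeterMatrix V
  /-- The signs of the vertices. -/
  sign : V → ℤˣ

namespace MixedSignCoxeterGraph

section Graph

variable {V : Type*} (Γ : MixedSignCoxeterGraph V)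

/-- The underlying graph: distinct vertices are joined by an edge unless their weight is `2`. -/
def graph : SimpleGraph V where
  Adj i j := i ≠ j ∧ Γ.m i j ≠ 2
  symm := ⟨fun i j h => ⟨h.1.symm, by rw [Γ.m.symmetric]; exact h.2⟩⟩
  loopless := ⟨fun _ h => h.1 rfl⟩

/-- Every edge is simply-laced, that is, has weight `3`. -/
def IsSimplyLaced : Prop := ∀ i j, Γ.graph.Adj i j → Γ.m i j = 3

/-- The underlying graph is a simple cycle with `n` vertices. -/
def IsSimpleCycle (n : ℕ) : Prop :=
  3 ≤ n ∧ Nonempty (Γ.graph ≃g SimpleGraph.cycleGraph n)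

end Graph

variable {V : Type*} [Fintype V] [DecidableEq V] (Γ : MixedSignCoxeterGraph V)

/-- The matrix of the symmetric bilinear form in the standard basis. -/
def gram : Matrix V V ℝ := Matrix.of fun i j =>
  if i = j then 2 * ((Γ.sign i : ℤ) : ℝ)
  else if Γ.m i j = 0 then -2
  else -2 * Real.cos (Real.pi / (Γ.m i j : ℝ))

/-- The symmetric bilinear form `B` on `ℝ^V`. -/
def form : LinearMap.BilinForm ℝ (V → ℝ) := Matrix.toBilin' Γ.gram

theorem form_single (i j : V) :
    Γ.form (Pi.single i 1) (Pi.single j 1) = Γ.gram i j := by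
  simp [form, Matrix.toBilin'_single]

theorem form_self_ne_zero (i : V) : Γ.form (Pi.single i 1) (Pi.single i 1) ≠ 0 := by
  rw [form_single]
  rcases Int.units_eq_one_or (Γ.sign i) with h | h <;> simp [gram, h]

/-- The reflection `v ↦ v - (2 B(eᵢ, v) / B(eᵢ, eᵢ)) eᵢ` of `ℝ^V` attached to the vertex `i`. -/
def reflection (i : V) : (V → ℝ) ≃ₗ[ℝ] (V → ℝ) :=
  Module.reflection (x := (Pi.single i 1 : V → ℝ))
    (f := (2 / Γ.form (Pi.single i 1) (Pi.single i 1)) • Γ.form (Pi.single i 1))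
    (by simpa using div_mul_cancel₀ 2 (Γ.form_self_ne_zero i))

theorem reflection_single (i j : V) :
    Γ.reflection i (Pi.single j 1) = Pi.single j 1 -
      (2 * Γ.form (Pi.single i 1) (Pi.single j 1) / Γ.form (Pi.single i 1) (Pi.single i 1)) •
        (Pi.single i 1 : V → ℝ) := by
  rw [reflection, Module.reflection_apply, LinearMap.smul_apply, smul_eq_mul, div_mul_eq_mul_div]

/-- The mixed-sign Coxeter group `W(Γ)`: the group of linear automorphisms of `ℝ^V` generated by
the reflections attached to the vertices. -/
def coxeterGroup : Subgroup ((V → ℝ) ≃ₗ[ℝ] (V → ℝ)) :=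
  Subgroup.closure (Set.range Γ.reflection)

end MixedSignCoxeterGraph

end

/-! If simple roots and coroots pair as a simply-laced Coxeter graph prescribes, and the roots lie
in an open half-space, then their reflections generate the Coxeter group: the action is faithful
because a lengthening simple reflection corresponds to a positive root (`toHom_root_mem_closure`).
Linear independence of the roots is not needed.

Reflections do not change when a vector or the form changes sign. If all signs are `+1`, the
standard basis realizes the cycle. If all are `-1`, pass to `-B`, which makes every edge positive.
Alternating signs along an even cycle make every edge negative again, so the group is still affine.

On an odd cycle one positive edge survives, between `a 0` and `a (n - 1)`. Reflecting `a (n - 1)`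
successively in `a 0, …, a (n - 3)` replaces it by a vector joined only to `a (n - 3)`. With `a 0,
…, a (n - 2)` this is a type `D` system, and the replacement only conjugates a generator by other
generators (`closure_reflection_eq`). -/

noncomputable section

/-! ### Faithfulness of simply-laced reflection realizations -/

section SimplyLacedReflections

variable {V E : Type*} [AddCommGroup E] [Module ℝ E]

theorem simplyLacedCoxeterMatrix_of_adj {G : SimpleGraph V} {i j : V} (h : G.Adj i j) :
    simplyLacedCoxeterMatrix G i j = 3 := by
  classical
  change (if i = j then 1 else if G.Adj i j then 3 else 2) = 3
  rw [if_neg h.ne, if_pos h]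

theorem simplyLacedCoxeterMatrix_of_not_adj {G : SimpleGraph V} {i j : V} (hij : i ≠ j)
    (h : ¬ G.Adj i j) : simplyLacedCoxeterMatrix G i j = 2 := by
  classical
  change (if i = j then 1 else if G.Adj i j then 3 else 2) = 2
  rw [if_neg hij, if_neg h]

/-- A realization of the simply-laced Coxeter graph `G` by simple roots and coroots in a real vector
space, for which the simple roots lie in an open half-space. -/
structure SimplyLacedRealization (G : SimpleGraph V) (E : Type*) [AddCommGroup E]
    [Module ℝ E] where
  /-- The simple roots. -/
  root : V → E
  /-- The simple coroots. -/
  coroot : V → Module.Dual ℝ E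
  coroot_self : ∀ i, coroot i (root i) = 2
  coroot_of_adj : ∀ i j, G.Adj i j → coroot i (root j) = -1
  coroot_of_not_adj : ∀ i j, i ≠ j → ¬ G.Adj i j → coroot i (root j) = 0
  /-- A linear form which is positive on the simple roots. -/
  height : Module.Dual ℝ E
  height_pos : ∀ i, 0 < height (root i)

namespace SimplyLacedRealization

variable {G : SimpleGraph V} (R : SimplyLacedRealization G E)

/-- The simple reflections of a realization. -/
def reflection (i : V) : E ≃ₗ[ℝ] E := Module.reflection (R.coroot_self i)

theorem reflection_apply (i : V) (x : E) : R.reflection i x = x - R.coroot i x • R.root i :=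
  Module.reflection_apply _ _

theorem isLiftable_reflection : (simplyLacedCoxeterMatrix G).IsLiftable R.reflection := by
  intro i j
  rcases eq_or_ne i j with rfl | hij
  · rw [(simplyLacedCoxeterMatrix G).diagonal, pow_one]
    ext x
    exact Module.involutive_reflection _ x
  by_cases h : G.Adj i j
  · rw [simplyLacedCoxeterMatrix_of_adj h]
    ext x
    simp only [pow_succ, pow_zero, one_mul, LinearEquiv.mul_apply, LinearEquiv.coe_one, id_eq,
      reflection_apply, map_sub, map_smul, R.coroot_self, R.coroot_of_adj i j h,
      R.coroot_of_adj j i h.symm]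
    module
  · rw [simplyLacedCoxeterMatrix_of_not_adj hij h]
    ext x
    simp only [pow_succ, pow_zero, one_mul, LinearEquiv.mul_apply, LinearEquiv.coe_one, id_eq,
      reflection_apply, map_sub, map_smul, R.coroot_self, R.coroot_of_not_adj i j hij h,
      R.coroot_of_not_adj j i hij.symm (fun h' => h h'.symm)]
    module

variable (G) in
/-- The Coxeter system of a simply-laced Coxeter graph. -/
abbrev coxeterSystem :
    CoxeterSystem (simplyLacedCoxeterMatrix G) (simplyLacedCoxeterMatrix G).Group :=
  (simplyLacedCoxeterMatrix G).toCoxeterSystem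

/-- The action of the Coxeter group on a realization. -/
def toHom : (simplyLacedCoxeterMatrix G).Group →* (E ≃ₗ[ℝ] E) :=
  (coxeterSystem G).lift ⟨R.reflection, R.isLiftable_reflection⟩

theorem toHom_simple (i : V) : R.toHom ((coxeterSystem G).simple i) = R.reflection i :=
  CoxeterSystem.lift_apply_simple _ R.isLiftable_reflection i

/-- The key fact about simple roots: an element which is lengthened by right multiplication
with a simple reflection maps the corresponding simple root to a positive root. -/
theorem toHom_root_mem_closure (w : (simplyLacedCoxeterMatrix G).Group) (i : V)
    (h : (coxeterSystem G).length w < (coxeterSystem G).length (w * (coxeterSystem G).simple i)) :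
    R.toHom w (R.root i) ∈ AddSubmonoid.closure (Set.range R.root) := by
  set cs := coxeterSystem G
  induction hn : cs.length w using Nat.strong_induction_on generalizing w i with
  | _ n ih =>
  subst hn
  rcases eq_or_ne w 1 with rfl | hw
  · rw [map_one]
    exact AddSubmonoid.subset_closure ⟨i, rfl⟩
  obtain ⟨j, hj⟩ := cs.exists_rightDescent_of_ne_one hw
  have hij : i ≠ j := by rintro rfl; exact lt_asymm h hj
  obtain ⟨v, rfl⟩ : ∃ v, w = v * cs.simple j :=
    ⟨w * cs.simple j, by simp⟩
  rw [CoxeterSystem.IsRightDescent, cs.simple_mul_simple_cancel_right] at hj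
  have hvj := ih _ hj v j hj rfl
  -- Reduction to the dihedral group of `i` and `j`: strip final letters `i`, `j` from `w` and apply
  -- induction to the shorter element.
  by_cases hadj : G.Adj i j
  · have e : R.toHom (v * cs.simple j) (R.root i) =
        R.toHom v (R.root i) + R.toHom v (R.root j) := by
      rw [map_mul, LinearEquiv.mul_apply, toHom_simple, reflection_apply,
        R.coroot_of_adj j i hadj.symm, neg_one_smul, sub_neg_eq_add, map_add]
    rcases cs.length_mul_simple v i with hvi | hvi
    · rw [e]
      exact add_mem (ih _ hj v i (by omega) rfl) hvj
    · obtain ⟨u, rfl⟩ : ∃ u, v = u * cs.simple i := ⟨v * cs.simple i, by simp⟩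
      rw [cs.simple_mul_simple_cancel_right] at hvi
      have e' : R.toHom (u * cs.simple i * cs.simple j) (R.root i) = R.toHom u (R.root j) := by
        rw [e, ← map_add, map_mul, LinearEquiv.mul_apply, toHom_simple, reflection_apply, map_add,
          R.coroot_self, R.coroot_of_adj i j hadj]
        congr 1
        module
      rw [e']
      -- If `s_j` shortened `u`, the braid relation would write `w * s_i` as `u * s_j * s_i * s_j`,
      -- of length at most that of `u` plus one: too short for `h`.
      refine ih _ (by omega) u j ?_ rfl
      by_contra! hle
      have hlt := lt_of_le_of_ne hle (cs.length_mul_simple_ne u j)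
      have hbraid : cs.simple i * cs.simple j * cs.simple i =
          cs.simple j * cs.simple i * cs.simple j := by
        have h3 := cs.simple_mul_simple_pow i j
        rw [simplyLacedCoxeterMatrix_of_adj hadj] at h3
        have h3' : cs.simple i * cs.simple j * cs.simple i *
            (cs.simple j * cs.simple i * cs.simple j) = 1 := by
          rw [← h3]
          simp only [pow_succ, pow_zero, one_mul, mul_assoc]
        rw [mul_eq_one_iff_eq_inv.mp h3']
        simp only [mul_inv_rev, cs.inv_simple, mul_assoc]
      have : u * cs.simple i * cs.simple j * cs.simple i =
          u * cs.simple j * cs.simple i * cs.simple j := by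
        simpa only [mul_assoc] using congrArg (u * ·) hbraid
      rw [this] at h
      have h1 := cs.length_mul_le (u * cs.simple j * cs.simple i) (cs.simple j)
      have h2 := cs.length_mul_le (u * cs.simple j) (cs.simple i)
      rw [cs.length_simple] at h1 h2
      omega
  · have hcomm : cs.simple j * cs.simple i = cs.simple i * cs.simple j := by
      have h2 := cs.simple_mul_simple_pow i j
      rw [simplyLacedCoxeterMatrix_of_not_adj hij hadj, pow_two, mul_eq_one_iff_eq_inv] at h2
      simpa using h2.symm
    rw [map_mul, LinearEquiv.mul_apply, toHom_simple, reflection_apply,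
      R.coroot_of_not_adj j i hij.symm (fun h' => hadj h'.symm), zero_smul, sub_zero]
    refine ih _ hj v i ?_ rfl
    by_contra! hle
    have hlt := lt_of_le_of_ne hle (cs.length_mul_simple_ne v i)
    rw [mul_assoc, hcomm, ← mul_assoc] at h
    have h1 := cs.length_mul_le (v * cs.simple i) (cs.simple j)
    rw [cs.length_simple] at h1
    omega

/-- A nontrivial kernel element `w` has a right descent `i`. Then `w * s_i` is lengthened by `s_i`
but sends the root of `i` to its negative, which has negative height. -/
theorem toHom_injective : Function.Injective R.toHom := by
  rw [injective_iff_map_eq_one]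
  intro w hw
  by_contra hne
  obtain ⟨i, hi⟩ := (coxeterSystem G).exists_rightDescent_of_ne_one hne
  have hmem := R.toHom_root_mem_closure (w * (coxeterSystem G).simple i) i
    (by rwa [CoxeterSystem.simple_mul_simple_cancel_right])
  rw [map_mul, hw, one_mul, toHom_simple, reflection, Module.reflection_apply_self] at hmem
  have hnonneg : ∀ x ∈ AddSubmonoid.closure (Set.range R.root), 0 ≤ R.height x := by
    intro x hx
    induction hx using AddSubmonoid.closure_induction with
    | mem x hx => obtain ⟨j, rfl⟩ := hx; exact (R.height_pos j).le
    | zero => rw [map_zero]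
    | add x y _ _ hx hy => rw [map_add]; exact add_nonneg hx hy
  have := hnonneg _ hmem
  rw [map_neg] at this
  linarith [R.height_pos i]

theorem range_toHom : R.toHom.range = Subgroup.closure (Set.range R.reflection) := by
  rw [MonoidHom.range_eq_map, ← (coxeterSystem G).subgroup_closure_range_simple,
    MonoidHom.map_closure, ← Set.range_comp]
  congr 2

/-- The group generated by the simple reflections of a realization is the Coxeter group. -/
theorem nonempty_closure_mulEquiv :
    Nonempty (Subgroup.closure (Set.range R.reflection) ≃* (simplyLacedCoxeterMatrix G).Group) :=
  ⟨((MonoidHom.ofInjective R.toHom_injective).trans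
    (MulEquiv.subgroupCongr R.range_toHom)).symm⟩

end SimplyLacedRealization

end SimplyLacedReflections


/-! ### Arithmetic form of adjacency in the two graphs -/

theorem cycleGraph_adj_iff {n : ℕ} (hn : 3 ≤ n) {i j : Fin n} :
    (SimpleGraph.cycleGraph n).Adj i j ↔ (i : ℕ) + 1 = j ∨ (j : ℕ) + 1 = i ∨
      ((i : ℕ) = 0 ∧ (j : ℕ) + 1 = n) ∨ ((j : ℕ) = 0 ∧ (i : ℕ) + 1 = n) := by
  rw [SimpleGraph.cycleGraph_adj']
  have hi := i.2
  have hj := j.2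
  rcases lt_trichotomy i j with h | h | h
  · rw [Fin.coe_sub_iff_lt.mpr h, Fin.coe_sub_iff_le.mpr h.le]
    rw [Fin.lt_def] at h
    omega
  · subst h
    rw [Fin.coe_sub_iff_le.mpr le_rfl]
    omega
  · rw [Fin.coe_sub_iff_lt.mpr h, Fin.coe_sub_iff_le.mpr h.le]
    rw [Fin.lt_def] at h
    omega

theorem typeDGraph_adj_iff {n : ℕ} {i j : Fin n} : (typeDGraph n).Adj i j ↔
    (((i : ℕ) + 1 = j ∧ (j : ℕ) + 1 < n) ∨ ((i : ℕ) + 2 = j ∧ (j : ℕ) + 1 = n)) ∨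
    (((j : ℕ) + 1 = i ∧ (i : ℕ) + 1 < n) ∨ ((j : ℕ) + 2 = i ∧ (i : ℕ) + 1 = n)) := by
  rw [typeDGraph, SimpleGraph.fromRel_adj, and_iff_right_iff_imp]
  rintro h rfl
  omega

/-! ### Constant-sign cycles that can be rescaled to the affine realization -/

namespace MixedSignCoxeterGraph

variable {V : Type*} [Fintype V] [DecidableEq V] {Γ : MixedSignCoxeterGraph V}

theorem form_single_self (i : V) :
    Γ.form (Pi.single i 1) (Pi.single i 1) = 2 * ((Γ.sign i : ℤ) : ℝ) := by
  simp [form_single, gram]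

theorem IsSimplyLaced.form_single_of_adj (h : Γ.IsSimplyLaced) {i j : V} (hij : Γ.graph.Adj i j) :
    Γ.form (Pi.single i 1) (Pi.single j 1) = -1 := by
  simp [form_single, gram, hij.ne, h i j hij]

theorem form_single_of_not_adj {i j : V} (hne : i ≠ j) (hij : ¬ Γ.graph.Adj i j) :
    Γ.form (Pi.single i 1) (Pi.single j 1) = 0 := by
  have h2 : Γ.m i j = 2 := by
    by_contra h
    exact hij ⟨hne, h⟩
  simp [form_single, gram, hne, h2]

theorem reflection_apply_of_sign {σ : ℤˣ} {i : V} (h : Γ.sign i = σ) (x : V → ℝ) :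
    Γ.reflection i x =
      x - (((σ : ℤ) : ℝ) * Γ.form (Pi.single i 1) x) • (Pi.single i 1 : V → ℝ) := by
  rw [reflection, Module.reflection_apply, LinearMap.smul_apply, smul_eq_mul, form_single_self, h]
  rcases Int.units_eq_one_or σ with rfl | rfl <;> norm_num

theorem form_comm (x y : V → ℝ) : Γ.form x y = Γ.form y x := by
  have h : Γ.form.IsSymm := by
    rw [form, Matrix.isSymm_toBilin'_iff_isSymm]
    ext i j
    simp only [Matrix.transpose_apply, gram, Matrix.of_apply, Γ.m.symmetric j i, eq_comm (a := j)]
    split_ifs with hij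
    · rw [hij]
    all_goals rfl
  exact h.eq x y

/-- The realization of the cycle obtained by rescaling the standard basis by signs `ε`. -/
def cycleRealization {n : ℕ} (hΓ : Γ.IsSimplyLaced) (e : Γ.graph ≃g SimpleGraph.cycleGraph n)
    {σ : ℤˣ} (hσ : ∀ v, Γ.sign v = σ) (ε : Fin n → ℤˣ)
    (hε : ∀ i j, (SimpleGraph.cycleGraph n).Adj i j → σ * ε i * ε j = 1) :
    SimplyLacedRealization (SimpleGraph.cycleGraph n) (V → ℝ) where
  root i := ((ε i : ℤ) : ℝ) • Pi.single (e.symm i) 1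
  -- The factor `σ` makes the self-pairing `2`; `ε i` occurs in both root and coroot, so it cancels
  -- in the reflection.
  coroot i := (((σ * ε i : ℤˣ) : ℤ) : ℝ) • Γ.form (Pi.single (e.symm i) 1)
  coroot_self i := by
    rw [LinearMap.smul_apply, map_smul, form_single_self, hσ]
    rcases Int.units_eq_one_or σ with rfl | rfl <;>
      rcases Int.units_eq_one_or (ε i) with h | h <;> norm_num [h]
  coroot_of_adj i j hij := by
    rw [LinearMap.smul_apply, map_smul, hΓ.form_single_of_adj (e.symm.map_adj_iff.mpr hij),
      smul_eq_mul, smul_eq_mul, ← mul_assoc, ← Int.cast_mul, ← Units.val_mul, hε i j hij]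
    norm_num
  coroot_of_not_adj i j hne hij := by
    rw [LinearMap.smul_apply, map_smul, form_single_of_not_adj (e.symm.injective.ne hne)
      (fun h => hij (e.symm.map_adj_iff.mp h)), smul_zero, smul_zero]
  height := ∑ i, ((ε i : ℤ) : ℝ) • LinearMap.proj (e.symm i)
  height_pos i := by
    rw [map_smul, LinearMap.sum_apply, Finset.sum_eq_single i]
    · rcases Int.units_eq_one_or (ε i) with h | h <;> norm_num [h]
    · intro j _ hj
      simp [Pi.single_eq_of_ne (e.symm.injective.ne hj)]
    · simp

theorem nonempty_mulEquiv_affineSymmetricGroup {n : ℕ} (hΓ : Γ.IsSimplyLaced)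
    (e : Γ.graph ≃g SimpleGraph.cycleGraph n) {σ : ℤˣ} (hσ : ∀ v, Γ.sign v = σ)
    (ε : Fin n → ℤˣ) (hε : ∀ i j, (SimpleGraph.cycleGraph n).Adj i j → σ * ε i * ε j = 1) :
    Nonempty (Γ.coxeterGroup ≃* AffineSymmetricGroup n) := by
  have h : Γ.reflection ∘ e.symm = (cycleRealization hΓ e hσ ε hε).reflection := by
    funext i
    ext1 x
    rw [Function.comp_apply, reflection_apply_of_sign (hσ _),
      SimplyLacedRealization.reflection_apply]
    simp only [cycleRealization, LinearMap.smul_apply, smul_eq_mul, smul_smul]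
    rcases Int.units_eq_one_or (ε i) with h | h <;> simp [h]
  rw [coxeterGroup, ← e.symm.surjective.range_comp, h]
  exact SimplyLacedRealization.nonempty_closure_mulEquiv _

end MixedSignCoxeterGraph


/-! ### From an unbalanced cycle to type `D` -/

section TypeD

variable {E : Type*} [AddCommGroup E] [Module ℝ E]

/-- Vectors `a 0, …, a (n - 1)` whose Gram matrix is that of a cycle with one positive edge,
between `a 0` and `a (n - 1)`, all other edges being negative. -/
structure UnbalancedCycle (n : ℕ) (E : Type*) [AddCommGroup E] [Module ℝ E] where
  /-- The bilinear form. -/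
  form : LinearMap.BilinForm ℝ E
  form_comm : ∀ x y, form x y = form y x
  /-- The vertices of the cycle. -/
  vec : ℕ → E
  form_self : ∀ i, i < n → form (vec i) (vec i) = 2
  form_succ : ∀ i, i + 1 < n → form (vec i) (vec (i + 1)) = -1
  form_last : form (vec 0) (vec (n - 1)) = 1
  form_of_lt : ∀ i j, i + 1 < j → j < n → ¬ (i = 0 ∧ j + 1 = n) → form (vec i) (vec j) = 0
  /-- A linear form which is `1` on all vertices but the last. -/
  height : Module.Dual ℝ E
  height_vec : ∀ i, i + 1 < n → height (vec i) = 1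
  height_last : height (vec (n - 1)) = n - 1

namespace UnbalancedCycle

variable {n : ℕ} (C : UnbalancedCycle n E)

theorem form_vec_vec {i j : ℕ} (hi : i + 1 < n) (hj : j + 1 < n) : C.form (C.vec i) (C.vec j) =
    if i = j then 2 else if i + 1 = j ∨ j + 1 = i then -1 else 0 := by
  split_ifs with h1 h2
  · rw [h1, C.form_self j (by omega)]
  · rcases h2 with rfl | rfl
    · exact C.form_succ i (by omega)
    · rw [C.form_comm, C.form_succ j (by omega)]
  · rcases lt_or_gt_of_ne h1 with h | h
    · exact C.form_of_lt i j (by omega) (by omega) (by omega)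
    · rw [C.form_comm]
      exact C.form_of_lt j i (by omega) (by omega) (by omega)

theorem form_vec_last (hn : 3 ≤ n) {i : ℕ} (hi : i + 1 < n) : C.form (C.vec i) (C.vec (n - 1)) =
    if i = 0 then 1 else if i + 2 = n then -1 else 0 := by
  split_ifs with h1 h2
  · rw [h1, C.form_last]
  · rw [← C.form_succ i hi]
    congr 2
    omega
  · exact C.form_of_lt i (n - 1) (by omega) (by omega) (by omega)

/-- The last vertex of the cycle, reflected successively in the vertices `0, …, k - 1`. -/
def fold (k : ℕ) : E := C.vec (n - 1) - ∑ j ∈ Finset.range k, C.vec j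

theorem fold_zero : C.fold 0 = C.vec (n - 1) := by simp [fold]

theorem fold_succ (k : ℕ) : C.fold (k + 1) = C.fold k - C.vec k := by
  rw [fold, fold, Finset.sum_range_succ, sub_sub]

/-- Folding moves the positive edge along the path. At `k = n - 2` it meets the negative edge to `a
(n - 2)` and the two cancel, leaving only the edge to `a (n - 3)`. -/
theorem form_vec_fold (hn : 3 ≤ n) {i k : ℕ} (hi : i + 1 < n) (hk : k + 2 ≤ n) :
    C.form (C.vec i) (C.fold k) =
      (if i = k then 1 else 0) - (if i + 1 = k then 1 else 0) - (if i + 2 = n then 1 else 0) := by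
  induction k with
  | zero =>
    rw [fold_zero, C.form_vec_last hn hi]
    split_ifs <;> first | contradiction | omega | norm_num
  | succ k ih =>
    rw [fold_succ, map_sub, ih (by omega), C.form_vec_vec hi (by omega)]
    split_ifs <;> first | contradiction | omega | norm_num

theorem form_vec_fold_self (hn : 3 ≤ n) {k : ℕ} (hk : k + 2 < n) :
    C.form (C.vec k) (C.fold k) = 1 := by
  rw [C.form_vec_fold hn (by omega) hk.le, if_pos rfl, if_neg (by omega), if_neg (by omega)]
  norm_num

theorem form_fold_self (hn : 3 ≤ n) {k : ℕ} (hk : k + 2 ≤ n) :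
    C.form (C.fold k) (C.fold k) = 2 := by
  induction k with
  | zero => rw [fold_zero, C.form_self _ (by omega)]
  | succ k ih =>
    rw [fold_succ, map_sub, map_sub, LinearMap.sub_apply, LinearMap.sub_apply, ih (by omega),
      C.form_comm (C.fold k), C.form_vec_fold_self hn (by omega), C.form_self k (by omega)]
    norm_num

/-- Since `a k` pairs to `1` with the `k`-th fold, subtracting `a k` is reflecting in it;
reflections in the images are conjugate. -/
theorem reflection_fold_succ (hn : 3 ≤ n) {k : ℕ} (hk : k + 2 < n) :
    Module.reflection (C.form_fold_self hn (k := k + 1) hk) =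
      Module.reflection (C.form_self k (by omega)) *
        Module.reflection (C.form_fold_self hn hk.le) *
        Module.reflection (C.form_self k (by omega)) := by
  ext x
  simp only [LinearEquiv.mul_apply, Module.reflection_apply, map_sub, map_smul, fold_succ,
    LinearMap.sub_apply, C.form_comm (C.fold k) (C.vec k), C.form_vec_fold_self hn hk,
    C.form_self k (by omega : k < n)]
  module

theorem reflection_fold_mem_iff (hn : 3 ≤ n) {k : ℕ} (hk : k + 2 ≤ n)
    (K : Subgroup (E ≃ₗ[ℝ] E))
    (hK : ∀ i (hi : i + 1 < n), Module.reflection (C.form_self i (by omega)) ∈ K) :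
    Module.reflection (C.form_fold_self hn hk) ∈ K ↔
      Module.reflection (C.form_self (n - 1) (by omega)) ∈ K := by
  induction k with
  | zero => simp only [fold_zero]
  | succ k ih =>
    rw [← ih (by omega) hK, C.reflection_fold_succ hn hk,
      K.mul_mem_cancel_right (hK k (by omega)), K.mul_mem_cancel_left (hK k (by omega))]

theorem height_fold {k : ℕ} (hk : k + 1 ≤ n) : C.height (C.fold k) = n - 1 - k := by
  rw [fold, map_sub, C.height_last, map_sum,
    Finset.sum_congr rfl fun i hi => C.height_vec i (by rw [Finset.mem_range] at hi; omega)]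
  simp

/-- The simple roots of type `D`. -/
def typeDRoot (i : Fin n) : E := if (i : ℕ) + 1 < n then C.vec i else C.fold (n - 2)

theorem typeDRoot_of_lt {i : Fin n} (hi : (i : ℕ) + 1 < n) : C.typeDRoot i = C.vec i := if_pos hi

theorem typeDRoot_of_not_lt {i : Fin n} (hi : ¬ (i : ℕ) + 1 < n) :
    C.typeDRoot i = C.fold (n - 2) := if_neg hi

theorem form_typeDRoot_self (hn : 3 ≤ n) (i : Fin n) :
    C.form (C.typeDRoot i) (C.typeDRoot i) = 2 := by
  by_cases hi : (i : ℕ) + 1 < n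
  · rw [C.typeDRoot_of_lt hi, C.form_self i i.2]
  · rw [C.typeDRoot_of_not_lt hi, C.form_fold_self hn (by omega)]

open scoped Classical in
theorem form_typeDRoot_of_lt (hn : 3 ≤ n) {i j : Fin n} (hij : i < j) :
    C.form (C.typeDRoot i) (C.typeDRoot j) = if (typeDGraph n).Adj i j then -1 else 0 := by
  have hj2 := j.2
  rw [Fin.lt_def] at hij
  simp only [typeDGraph_adj_iff]
  rw [C.typeDRoot_of_lt (by omega)]
  by_cases hj : (j : ℕ) + 1 < n
  · rw [C.typeDRoot_of_lt hj, C.form_vec_vec (by omega) hj]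
    split_ifs <;> first | omega | rfl
  · rw [C.typeDRoot_of_not_lt hj, C.form_vec_fold hn (by omega) (by omega)]
    split_ifs <;> first | contradiction | omega | norm_num

open scoped Classical in
theorem form_typeDRoot_of_ne (hn : 3 ≤ n) {i j : Fin n} (hij : i ≠ j) :
    C.form (C.typeDRoot i) (C.typeDRoot j) = if (typeDGraph n).Adj i j then -1 else 0 := by
  rcases lt_or_gt_of_ne hij with h | h
  · exact C.form_typeDRoot_of_lt hn h
  · rw [C.form_comm, C.form_typeDRoot_of_lt hn h, SimpleGraph.adj_comm]

/-- The realization of the Coxeter graph of type `D`. -/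
def typeDRealization (hn : 3 ≤ n) : SimplyLacedRealization (typeDGraph n) E where
  root := C.typeDRoot
  coroot i := C.form (C.typeDRoot i)
  coroot_self := C.form_typeDRoot_self hn
  coroot_of_adj i j h := by rw [C.form_typeDRoot_of_ne hn h.ne, if_pos h]
  coroot_of_not_adj i j hij h := by rw [C.form_typeDRoot_of_ne hn hij, if_neg h]
  height := C.height
  height_pos i := by
    by_cases hi : (i : ℕ) + 1 < n
    · rw [C.typeDRoot_of_lt hi, C.height_vec i hi]
      exact one_pos
    -- Height `n - 1` on the last vertex leaves exactly `1` after `n - 2` subtractions.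
    · rw [C.typeDRoot_of_not_lt hi, C.height_fold (by omega), Nat.cast_sub (by omega)]
      norm_num

theorem closure_reflection_eq (hn : 3 ≤ n) :
    Subgroup.closure (Set.range fun i : Fin n => Module.reflection (C.form_self i i.2)) =
      Subgroup.closure (Set.range (C.typeDRealization hn).reflection) := by
  have hlt : ∀ i : Fin n, (i : ℕ) + 1 < n →
      (C.typeDRealization hn).reflection i = Module.reflection (C.form_self i i.2) := by
    intro i hi
    ext1 x
    rw [SimplyLacedRealization.reflection_apply, Module.reflection_apply]
    simp only [typeDRealization, C.typeDRoot_of_lt hi]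
  have hlast : ∀ i : Fin n, ¬ (i : ℕ) + 1 < n → (C.typeDRealization hn).reflection i =
      Module.reflection (C.form_fold_self hn (k := n - 2) (by omega)) := by
    intro i hi
    ext1 x
    rw [SimplyLacedRealization.reflection_apply, Module.reflection_apply]
    simp only [typeDRealization, C.typeDRoot_of_not_lt hi]
  refine le_antisymm ((Subgroup.closure_le _).mpr ?_) ((Subgroup.closure_le _).mpr ?_)
  · have hmem : ∀ i (hi : i + 1 < n), Module.reflection (C.form_self i (by omega)) ∈
        Subgroup.closure (Set.range (C.typeDRealization hn).reflection) := fun i hi =>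
      Subgroup.subset_closure ⟨⟨i, by omega⟩, hlt ⟨i, by omega⟩ hi⟩
    rintro _ ⟨i, rfl⟩
    by_cases hi : (i : ℕ) + 1 < n
    · exact hmem i hi
    · have h := (C.reflection_fold_mem_iff hn (k := n - 2) (by omega) _ hmem).mp
        (Subgroup.subset_closure ⟨i, hlast i hi⟩)
      have hi' : (i : ℕ) = n - 1 := by omega
      simpa only [hi', SetLike.mem_coe] using h
  · have hmem : ∀ i (hi : i < n), Module.reflection (C.form_self i hi) ∈
        Subgroup.closure (Set.range fun i : Fin n => Module.reflection (C.form_self i i.2)) :=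
      fun i hi => Subgroup.subset_closure ⟨⟨i, hi⟩, rfl⟩
    rintro _ ⟨i, rfl⟩
    by_cases hi : (i : ℕ) + 1 < n
    · rw [hlt i hi]
      exact hmem i i.2
    · rw [hlast i hi]
      exact (C.reflection_fold_mem_iff hn (by omega) _ fun i hi => hmem i (by omega)).mpr
        (hmem _ (by omega))

theorem nonempty_closure_mulEquiv (hn : 3 ≤ n) :
    Nonempty (Subgroup.closure
      (Set.range fun i : Fin n => Module.reflection (C.form_self i i.2)) ≃*
        TypeDCoxeterGroup n) := by
  rw [C.closure_reflection_eq hn]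
  exact SimplyLacedRealization.nonempty_closure_mulEquiv _

end UnbalancedCycle

end TypeD


/-! ### Odd negative cycles as unbalanced cycles -/

namespace MixedSignCoxeterGraph

variable {V : Type*} [DecidableEq V] {Γ : MixedSignCoxeterGraph V}

/-- The standard basis vectors along the cycle, rescaled by alternating signs. -/
def alternatingVec {n : ℕ} (e : Γ.graph ≃g SimpleGraph.cycleGraph n) (k : ℕ) : V → ℝ :=
  if h : k < n then (-1 : ℝ) ^ k • Pi.single (e.symm ⟨k, h⟩) 1 else 0

theorem alternatingVec_of_lt {n : ℕ} (e : Γ.graph ≃g SimpleGraph.cycleGraph n) {k : ℕ}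
    (hk : k < n) : alternatingVec e k = (-1 : ℝ) ^ k • Pi.single (e.symm ⟨k, hk⟩) 1 :=
  dif_pos hk

variable [Fintype V]

theorem form_alternatingVec {n : ℕ} (e : Γ.graph ≃g SimpleGraph.cycleGraph n) {i j : ℕ}
    (hi : i < n) (hj : j < n) : Γ.form (alternatingVec e i) (alternatingVec e j) =
      (-1 : ℝ) ^ (i + j) *
        Γ.form (Pi.single (e.symm ⟨i, hi⟩) 1) (Pi.single (e.symm ⟨j, hj⟩) 1) := by
  rw [alternatingVec_of_lt e hi, alternatingVec_of_lt e hj, map_smul, LinearMap.map_smul₂,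
    smul_eq_mul, smul_eq_mul, pow_add]
  ring

theorem IsSimplyLaced.form_alternatingVec_of_adj {n : ℕ} (hΓ : Γ.IsSimplyLaced)
    (e : Γ.graph ≃g SimpleGraph.cycleGraph n) {i j : ℕ} (hi : i < n) (hj : j < n)
    (hij : (SimpleGraph.cycleGraph n).Adj ⟨i, hi⟩ ⟨j, hj⟩) :
    Γ.form (alternatingVec e i) (alternatingVec e j) = -(-1 : ℝ) ^ (i + j) := by
  rw [form_alternatingVec e hi hj, hΓ.form_single_of_adj (e.symm.map_adj_iff.mpr hij), mul_neg_one]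

/-- An odd cycle, all of whose signs are `-1`, is unbalanced. -/
def unbalancedCycle {n : ℕ} (hn : 3 ≤ n) (hodd : Odd n) (hΓ : Γ.IsSimplyLaced)
    (e : Γ.graph ≃g SimpleGraph.cycleGraph n) (hσ : ∀ v, Γ.sign v = -1) :
    UnbalancedCycle n (V → ℝ) where
  form := -Γ.form
  form_comm x y := congrArg Neg.neg (form_comm x y)
  vec := alternatingVec e
  form_self i hi := by
    rw [LinearMap.neg_apply, LinearMap.neg_apply, form_alternatingVec e hi hi, form_single_self,
      hσ, (Even.add_self i).neg_one_pow]
    norm_num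
  form_succ i hi := by
    rw [LinearMap.neg_apply, LinearMap.neg_apply, hΓ.form_alternatingVec_of_adj e (by omega) hi
      ((cycleGraph_adj_iff hn).mpr (Or.inl rfl)), neg_neg, Odd.neg_one_pow ⟨i, by ring⟩]
  -- The closing edge has even index sum `n - 1`, so unlike the others it keeps its positive sign.
  form_last := by
    rw [LinearMap.neg_apply, LinearMap.neg_apply, hΓ.form_alternatingVec_of_adj e (by omega)
      (by omega) ((cycleGraph_adj_iff hn).mpr
        (Or.inr (Or.inr (Or.inl ⟨rfl, Nat.sub_add_cancel (by omega)⟩)))), neg_neg, zero_add,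
      (Nat.Odd.sub_odd hodd odd_one).neg_one_pow]
  form_of_lt i j hij hj h := by
    rw [LinearMap.neg_apply, LinearMap.neg_apply, form_alternatingVec e (by omega) hj,
      form_single_of_not_adj, mul_zero, neg_zero]
    · intro h'
      have := Fin.mk.inj_iff.mp (e.symm.injective h')
      omega
    · rw [e.symm.map_adj_iff, cycleGraph_adj_iff hn]
      simp only
      omega
  -- The factors `(-1) ^ i` undo the rescaling of the basis vectors.
  height := ∑ i : Fin n,
    ((-1 : ℝ) ^ (i : ℕ) * if (i : ℕ) + 1 < n then 1 else (n : ℝ) - 1) • LinearMap.proj (e.symm i)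
  height_vec i hi := by
    rw [alternatingVec_of_lt e (by omega), map_smul, LinearMap.sum_apply,
      Finset.sum_eq_single ⟨i, by omega⟩]
    · simp [hi, ← pow_add]
    · intro j _ hj
      rw [LinearMap.smul_apply, LinearMap.proj_apply, Pi.single_eq_of_ne (e.symm.injective.ne hj),
        smul_zero]
    · simp
  height_last := by
    rw [alternatingVec_of_lt e (by omega), map_smul, LinearMap.sum_apply,
      Finset.sum_eq_single ⟨n - 1, by omega⟩]
    · simp [Nat.sub_add_cancel (by omega : 1 ≤ n), ← mul_assoc, ← pow_add]
    · intro j _ hj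
      rw [LinearMap.smul_apply, LinearMap.proj_apply, Pi.single_eq_of_ne (e.symm.injective.ne hj),
        smul_zero]
    · simp

theorem nonempty_mulEquiv_typeDCoxeterGroup {n : ℕ} (hn : 3 ≤ n) (hodd : Odd n)
    (hΓ : Γ.IsSimplyLaced) (e : Γ.graph ≃g SimpleGraph.cycleGraph n)
    (hσ : ∀ v, Γ.sign v = -1) : Nonempty (Γ.coxeterGroup ≃* TypeDCoxeterGroup n) := by
  have h : Γ.reflection ∘ e.symm = fun i : Fin n =>
      Module.reflection ((unbalancedCycle hn hodd hΓ e hσ).form_self i i.2) := by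
    funext i
    ext1 x
    rw [Function.comp_apply, reflection_apply_of_sign (hσ _), Module.reflection_apply]
    simp only [unbalancedCycle, alternatingVec_of_lt e i.2, LinearMap.neg_apply,
      LinearMap.map_smul₂, smul_eq_mul, smul_smul]
    rcases neg_one_pow_eq_or ℝ (i : ℕ) with h | h <;> simp [h]
  rw [coxeterGroup, ← e.symm.surjective.range_comp, h]
  exact UnbalancedCycle.nonempty_closure_mulEquiv _ hn

end MixedSignCoxeterGraph

end

theorem mainTheorem3 {V : Type*} [Fintype V] [DecidableEq V] (n : ℕ)
    (Γ : MixedSignCoxeterGraph V) (hlaced : Γ.IsSimplyLaced) (hcycle : Γ.IsSimpleCycle n) :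
    ((∀ v, Γ.sign v = 1) → Nonempty (Γ.coxeterGroup ≃* AffineSymmetricGroup n)) ∧
    ((∀ v, Γ.sign v = -1) →
      (Even n → Nonempty (Γ.coxeterGroup ≃* AffineSymmetricGroup n)) ∧
      (Odd n → Nonempty (Γ.coxeterGroup ≃* TypeDCoxeterGroup n))) := by
  obtain ⟨hn, ⟨e⟩⟩ := hcycle
  refine ⟨fun hσ => ?_, fun hσ => ⟨fun heven => ?_, fun hodd => ?_⟩⟩
  · exact MixedSignCoxeterGraph.nonempty_mulEquiv_affineSymmetricGroup hlaced e hσ (fun _ => 1)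
      fun _ _ _ => by simp
  · refine MixedSignCoxeterGraph.nonempty_mulEquiv_affineSymmetricGroup hlaced e hσ
      (fun i => (-1) ^ (i : ℕ)) fun i j hij => ?_
    -- Evenness of `n` is needed only for the closing edge between `0` and `n - 1`.
    have h : Odd ((i : ℕ) + j) := by
      rw [cycleGraph_adj_iff hn] at hij
      rw [Nat.odd_iff]
      rw [Nat.even_iff] at heven
      omega
    rw [mul_assoc, ← pow_add, h.neg_one_pow, neg_mul_neg, one_mul]
  · exact MixedSignCoxeterGraph.nonempty_mulEquiv_typeDCoxeterGroup hn hodd hlaced e hσ
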